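/- Let $\Delta\ge 3$ and $k\ge 5$ be integers, and let $n=2k(\Delta+1)$. For $\ell\ge 1$ let $J(\ell)$ be the graph with vertices $v_i^j$ ($1\le i\le \ell$, $1\le j\le\Delta+1$) in which, with lower indices modulo $\ell$, $v_{i+1}^{1}$ is joined to $v_i^{\Delta+1}$ for every $i$, and $v_i^j$ is joined to $v_i^{j'}$ for every $i$ and all $j\ne j'$ with $\{j,j'\}\neq\{1,\Delta+1\}$. Then $G=J(2k)$ is a $\Delta$-regular graph on $n$ vertices with the following property. Consider Glauber dynamics on the proper colourings of $G$ with $\Delta+1$ colours: at each step a vertex $v$ and a colour $c$ are chosen independently and uniformly at random, and $v$ is recoloured with $c$ if no neighbour of $v$ has colour $c$; otherwise nothing changes. Call a colouring frozen if every colour appears in the closed neighbourhood of every vertex. Then Glauber dynamics restricted to the set $\Omega_0$ of non-frozen colourings is a Markov chain on $\Omega_0$ that is ergodic (irreducible and aperiodic). It has a unique stationary distribution $\pi$, and its mixing time $$t_{\mathrm{mix}}=\min\Big\{t\ge 0:\ \max_{\alpha\in\Omega_0}\|P^t(\alpha,\cdot)-\pi\|_{TV}\le \tfrac14\Big\},$$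 where $P$ is the transition matrix of the restricted chain and $\|\mu-\nu\|_{TV}=\max_{A\subseteq\Omega_0}|\mu(A)-\nu(A)|$, satisfies $$t_{\mathrm{mix}}\ \ge\ \frac{n^2}{8(\Delta+1)}.$$ -/

import Mathlib

/-! ### Glauber dynamics on graph colourings -/

open Classical in
/-- The outcome of trying to recolour the vertex `v` with the colour `c`: if `c` does not appear in
the neighbours of `v`, then `v` receives the colour `c`; otherwise nothing changes. -/
noncomputable def recolour {V C : Type*} {G : SimpleGraph V} (α : G.Coloring C) (v : V) (c : C) :
    G.Coloring C :=
  if h : ∀ u, G.Adj v u → α u ≠ c then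
    SimpleGraph.Coloring.mk (Function.update α v c) (by
      intro a b hab
      by_cases ha : a = v
      · subst ha
        rw [Function.update_self, Function.update_of_ne hab.ne']
        exact (h b hab).symm
      · by_cases hb : b = v
        · subst hb
          rw [Function.update_self, Function.update_of_ne hab.ne]
          exact h a hab.symm
        · rw [Function.update_of_ne ha, Function.update_of_ne hb]
          exact α.valid hab)
  else α

/-- A colouring is frozen if every colour appears in the closed neighbourhood of every vertex. -/
def IsFrozen {V C : Type*} {G : SimpleGraph V} (α : G.Coloring C) : Prop :=
  ∀ (v : V) (c : C), ∃ u, (u = v ∨ G.Adj v u) ∧ α u = c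

/-- The set of non-frozen colourings of `G` with colours in `C`. -/
abbrev NonFrozen {V : Type*} (G : SimpleGraph V) (C : Type*) : Type _ :=
  {α : G.Coloring C // ¬ IsFrozen α}

noncomputable instance {V C : Type*} [Fintype V] [Fintype C] (G : SimpleGraph V) :
    Fintype (NonFrozen G C) :=
  Fintype.ofFinite _

noncomputable instance {V C : Type*} (G : SimpleGraph V) : DecidableEq (NonFrozen G C) :=
  Classical.decEq _

/-- The transition matrix of Glauber dynamics on the colourings of `G` with colours in `C`: the
entry at `(α, β)` is the probability that recolouring `α` at a vertex and with a colour chosen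
independently and uniformly at random gives `β`. -/
noncomputable def glauber {V : Type*} [Fintype V] (G : SimpleGraph V) (C : Type*) [Fintype C] :
    Matrix (G.Coloring C) (G.Coloring C) ℝ :=
  fun α β =>
    (Nat.card {p : V × C // recolour α p.1 p.2 = β} : ℝ) / (Fintype.card V * Fintype.card C)

/-- Glauber dynamics restricted to the non-frozen colourings. -/
noncomputable def glauberNonFrozen {V : Type*} [Fintype V] (G : SimpleGraph V)
    (C : Type*) [Fintype C] : Matrix (NonFrozen G C) (NonFrozen G C) ℝ :=
  (glauber G C).submatrix Subtype.val Subtype.val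

/-! ### Finite Markov chains -/

/-- A transition matrix is aperiodic if for every state `x` the greatest common divisor of
`{t ≥ 1 : P ^ t (x, x) > 0}` is `1`. -/
def IsAperiodic {S : Type*} [Fintype S] [DecidableEq S] (P : Matrix S S ℝ) : Prop :=
  ∀ (x : S) (d : ℕ), (∀ t : ℕ, 0 < t → 0 < (P ^ t) x x → d ∣ t) → d = 1

/-- `P` is the transition matrix of an irreducible and aperiodic Markov chain. -/
structure IsErgodicChain {S : Type*} [Fintype S] [DecidableEq S] (P : Matrix S S ℝ) : Prop where
  stochastic : P ∈ Matrix.rowStochastic ℝ S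
  irreducible : P.IsIrreducible
  aperiodic : IsAperiodic P

/-- `π` is a stationary probability distribution of the chain with transition matrix `P`. -/
structure IsStationaryDistribution {S : Type*} [Fintype S] (P : Matrix S S ℝ) (π : S → ℝ) :
    Prop where
  nonneg : ∀ x, 0 ≤ π x
  sum_eq_one : ∑ x, π x = 1
  stationary : Matrix.vecMul π P = π

/-- The total variation distance `max_{A ⊆ S} |μ(A) - ν(A)|`. -/
noncomputable def tvDist {S : Type*} [Fintype S] (μ ν : S → ℝ) : ℝ :=
  ⨆ A : Finset S, |∑ x ∈ A, μ x - ∑ x ∈ A, ν x|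

/-- `d(t)`, the largest distance to `π`, over all starting states, of the law after `t` steps. -/
noncomputable def mixDist {S : Type*} [Fintype S] [DecidableEq S] (P : Matrix S S ℝ)
    (π : S → ℝ) (t : ℕ) : ℝ :=
  ⨆ x : S, tvDist ((P ^ t) x) π

/-- The mixing time `min {t : d(t) ≤ 1/4}` of the chain with transition matrix `P` and stationary
distribution `π`. -/
noncomputable def mixingTime {S : Type*} [Fintype S] [DecidableEq S] (P : Matrix S S ℝ)
    (π : S → ℝ) : ℕ :=
  sInf {t : ℕ | mixDist P π t ≤ 1 / 4}

/-! ### The graph `J(ℓ)` -/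

/-- The graph `J(ℓ)` with parameter `Δ`. The pair `(j, i)` is the vertex `v_i^j`; both indices
are counted from zero, so that `j = 0` and `j = Fin.last Δ` are the first and the last class.
The edges join `v_{i+1}^0` to `v_i^Δ`, with `i + 1` taken modulo `ℓ`, and `v_i^j` to `v_i^{j'}` for
all `j ≠ j'`, except that `v_i^0` is not joined to `v_i^Δ` in this second way. -/
def graphJ (Δ ℓ : ℕ) : SimpleGraph (Fin (Δ + 1) × Fin ℓ) :=
  SimpleGraph.fromRel fun u v =>
    (u.1 = 0 ∧ v.1 = Fin.last Δ ∧ (u.2 : ℕ) = ((v.2 : ℕ) + 1) % ℓ) ∨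
    (u.2 = v.2 ∧ u.1 ≠ v.1 ∧
      ¬ (u.1 = 0 ∧ v.1 = Fin.last Δ) ∧ ¬ (u.1 = Fin.last Δ ∧ v.1 = 0))

instance (Δ ℓ : ℕ) : DecidableRel (graphJ Δ ℓ).Adj := fun u v => by
  unfold graphJ
  infer_instance

/-! Block `i` consists of the vertices `(j, i)`. If every `(j, i)` has colour `j`, the whole
colouring is frozen. Damage to one block can spread only slowly: an intact block next to a damaged
one can change only at the end facing the damage, and only to the colour of its other end
(`IsIntact.of_recolour`). So of the n(Δ+1) equally likely choices at most two enlarge `front`, the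
reach of the damage around block `0`, and then by one. If only block `0` is damaged at the start,
then for t < n²/(8(Δ+1)) the mean of `front` after t steps is at most 2t/(n(Δ+1)) ≤ k/(2(Δ+1)) ≤
k/8. By Markov's inequality the antipodal block `k` is still intact with probability at least 7/8.
The stationary law is uniform, because the transition matrix is symmetric, and swapping two colours
shows that it gives this event probability at most 1/2. The gap exceeds 1/4
(`le_mixingTime_of_slow`).

Since every state has positive holding probability, ergodicity reduces to connectivity
(`reach_of_not_isFrozen`). A block whose ends share a colour is open: it misses some colour, and
this slack lets it open the next block, hence all blocks around the cycle. Then the common end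
colours form a proper colouring of an even cycle with at least four colours, which can be driven to
the alternating pattern. The missing colours allow the middle vertices to be rearranged. -/

/-! ### Convergence of finite Markov chains -/

section MarkovChain

open Finset Matrix

variable {S : Type*} [Fintype S] [DecidableEq S]

theorem pow_apply_pos_mono {P : Matrix S S ℝ} (hP : ∀ x y, 0 ≤ P x y) (hd : ∀ x, 0 < P x x)
    {x y : S} {m n : ℕ} (hmn : m ≤ n) (h : 0 < (P ^ m) x y) : 0 < (P ^ n) x y := by
  induction n, hmn using Nat.le_induction with
  | base => exact h
  | succ n _ ih =>
    rw [pow_succ, mul_apply]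
    exact sum_pos' (fun z _ => mul_nonneg (pow_apply_nonneg hP n x z) (hP z y))
      ⟨y, mem_univ y, mul_pos ih (hd y)⟩

theorem exists_pow_apply_pos {P : Matrix S S ℝ} (hP : ∀ x y, 0 ≤ P x y) {x y : S}
    (h : Relation.ReflTransGen (fun x y => 0 < P x y) x y) : ∃ n, 0 < (P ^ n) x y := by
  induction h with
  | refl => exact ⟨0, by simp⟩
  | @tail y z _ hyz ih =>
    obtain ⟨n, hn⟩ := ih
    refine ⟨n + 1, ?_⟩
    rw [pow_succ, mul_apply]
    exact sum_pos' (fun w _ => mul_nonneg (pow_apply_nonneg hP n x w) (hP w z))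
      ⟨y, mem_univ y, mul_pos hn hyz⟩

/-- A connected chain that holds at every state with positive probability has a positive power. -/
theorem isPrimitive_of_connected {P : Matrix S S ℝ} (hP : ∀ x y, 0 ≤ P x y)
    (hd : ∀ x, 0 < P x x) (h : ∀ x y, Relation.ReflTransGen (fun x y => 0 < P x y) x y) :
    P.IsPrimitive := by
  choose n hn using fun p : S × S => exists_pow_apply_pos hP (h p.1 p.2)
  refine ⟨hP, univ.sup n + 1, Nat.succ_pos _, fun x y => ?_⟩
  exact pow_apply_pos_mono hP hd ((le_sup (f := n) (mem_univ (x, y))).trans (Nat.le_succ _))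
    (hn (x, y))

theorem isErgodicChain_of_isPrimitive {P : Matrix S S ℝ} (hs : P ∈ rowStochastic ℝ S)
    (hd : ∀ x, 0 < P x x) (h : P.IsPrimitive) : IsErgodicChain P where
  stochastic := hs
  irreducible := h.isIrreducible
  aperiodic x d hx := Nat.dvd_one.mp (hx 1 one_pos (by simpa using hd x))

/-- A stochastic matrix with positive entries contracts the `ℓ¹`-norm on vectors of sum zero. -/
theorem exists_contraction {Q : Matrix S S ℝ} (hQ : Q ∈ rowStochastic ℝ S)
    (hpos : ∀ x y, 0 < Q x y) :
    ∃ r : ℝ, 0 ≤ r ∧ r < 1 ∧ ∀ μ : S → ℝ, ∑ x, μ x = 0 →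
      ∑ y, |(μ ᵥ* Q) y| ≤ r * ∑ x, |μ x| := by
  rcases isEmpty_or_nonempty S with hS | hS
  · exact ⟨0, le_rfl, one_pos, fun μ _ => by simp⟩
  obtain ⟨p, hp⟩ := Finite.exists_min fun p : S × S => Q p.1 p.2
  -- Doeblin's argument: on vectors of sum zero, subtracting the least entry `δ` from every entry of
  -- `Q` changes nothing, and it leaves a nonnegative matrix with row sums `1 - card S * δ`.
  set δ := Q p.1 p.2 with hδ
  have hδpos : 0 < δ := hpos _ _
  have hrow := sum_row_of_mem_rowStochastic hQ
  refine ⟨1 - Fintype.card S * δ, ?_, ?_, fun μ hμ => ?_⟩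
  · have : ∑ _y : S, δ ≤ ∑ y, Q p.1 y := sum_le_sum fun y _ => hp (p.1, y)
    rw [hrow] at this
    simpa using this
  · have : 0 < (Fintype.card S : ℝ) := by exact_mod_cast Fintype.card_pos
    nlinarith
  · have key : ∀ y, |(μ ᵥ* Q) y| ≤ ∑ x, |μ x| * (Q x y - δ) := fun y => by
      have : (μ ᵥ* Q) y = ∑ x, μ x * (Q x y - δ) := by
        simp only [vecMul, dotProduct, mul_sub, sum_sub_distrib, ← sum_mul, hμ]
        ring
      rw [this]
      refine (abs_sum_le_sum_abs _ _).trans (sum_le_sum fun x _ => ?_)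
      rw [abs_mul, abs_of_nonneg (sub_nonneg.mpr (hp (x, y)))]
    calc ∑ y, |(μ ᵥ* Q) y| ≤ ∑ y, ∑ x, |μ x| * (Q x y - δ) := sum_le_sum fun y _ => key y
      _ = ∑ x, |μ x| * (1 - Fintype.card S * δ) := by
        rw [sum_comm]
        refine sum_congr rfl fun x _ => ?_
        rw [← mul_sum, sum_sub_distrib, hrow]
        simp
      _ = _ := by rw [← sum_mul, mul_comm]

theorem IsStationaryDistribution.vecMul_pow {P : Matrix S S ℝ} {π : S → ℝ}
    (h : IsStationaryDistribution P π) (n : ℕ) : π ᵥ* P ^ n = π := by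
  induction n with
  | zero => simp
  | succ n ih => rw [pow_succ, ← vecMul_vecMul, ih, h.stationary]

theorem IsStationaryDistribution.unique {P : Matrix S S ℝ} (hs : P ∈ rowStochastic ℝ S)
    (hP : P.IsPrimitive) {π ν : S → ℝ} (hπ : IsStationaryDistribution P π)
    (hν : IsStationaryDistribution P ν) : π = ν := by
  obtain ⟨N, -, hN⟩ := hP.exists_pos_pow
  obtain ⟨r, -, hr1, hr⟩ := exists_contraction (pow_mem hs N) hN
  have h := hr (π - ν) (by simp [hπ.sum_eq_one, hν.sum_eq_one])
  rw [sub_vecMul, hπ.vecMul_pow, hν.vecMul_pow] at h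
  have h0 : 0 ≤ ∑ x, |(π - ν) x| := sum_nonneg fun _ _ => abs_nonneg _
  have h1 : ∑ x, |(π - ν) x| = 0 := by nlinarith
  funext x
  have := (sum_eq_zero_iff_of_nonneg fun _ _ => abs_nonneg _).mp h1 x (mem_univ x)
  simpa [sub_eq_zero] using this

omit [DecidableEq S] in
theorem tvDist_le_sum_abs (μ ν : S → ℝ) : tvDist μ ν ≤ ∑ x, |μ x - ν x| := by
  refine ciSup_le fun A => ?_
  rw [← sum_sub_distrib]
  exact (abs_sum_le_sum_abs _ _).trans
    (sum_le_sum_of_subset_of_nonneg (subset_univ A) fun _ _ _ => abs_nonneg _)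

/-- The laws of a primitive chain converge to the stationary distribution. -/
theorem exists_mixDist_le {P : Matrix S S ℝ} (hs : P ∈ rowStochastic ℝ S)
    (hP : P.IsPrimitive) {π : S → ℝ} (hπ : IsStationaryDistribution P π) {ε : ℝ} (hε : 0 < ε) :
    ∃ t, mixDist P π t ≤ ε := by
  obtain ⟨N, -, hN⟩ := hP.exists_pos_pow
  obtain ⟨r, hr0, hr1, hr⟩ := exists_contraction (pow_mem hs N) hN
  have hsum : ∀ n (x : S), ∑ y, ((P ^ n) x y - π y) = 0 := fun n x => by
    rw [sum_sub_distrib, sum_row_of_mem_rowStochastic (pow_mem hs n), hπ.sum_eq_one, sub_self]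
  -- The constant 2 bounds the ℓ¹-distance of any two probability vectors.
  have hbound : ∀ n (x : S), ∑ y, |(P ^ (N * n)) x y - π y| ≤ r ^ n * 2 := by
    intro n x
    induction n with
    | zero =>
      calc ∑ y, |(P ^ (N * 0)) x y - π y| ≤ ∑ y, ((P ^ (N * 0)) x y + π y) :=
            sum_le_sum fun y _ => (abs_sub _ _).trans_eq (by
              rw [abs_of_nonneg (nonneg_of_mem_rowStochastic (pow_mem hs _)),
                abs_of_nonneg (hπ.nonneg y)])
        _ = r ^ 0 * 2 := by
          rw [sum_add_distrib, sum_row_of_mem_rowStochastic (pow_mem hs _), hπ.sum_eq_one]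
          norm_num
    | succ n ih =>
      have h := hr (fun y => (P ^ (N * n)) x y - π y) (hsum _ x)
      have heq : (fun y => (P ^ (N * n)) x y - π y) ᵥ* P ^ N
          = fun y => (P ^ (N * (n + 1))) x y - π y := by
        have : (fun y => (P ^ (N * n)) x y - π y) = (P ^ (N * n)) x - π := rfl
        rw [this, sub_vecMul, hπ.vecMul_pow, mul_add, mul_one, pow_add]
        rfl
      rw [heq] at h
      calc _ ≤ _ := h
        _ ≤ r * (r ^ n * 2) := mul_le_mul_of_nonneg_left ih hr0
        _ = _ := by ring
  obtain ⟨n, hn⟩ := exists_pow_lt_of_lt_one (half_pos hε) hr1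
  refine ⟨N * n, Real.iSup_le (fun x => ?_) hε.le⟩
  refine (tvDist_le_sum_abs _ _).trans ((hbound n x).trans ?_)
  linarith

theorem le_mixDist (P : Matrix S S ℝ) (π : S → ℝ) (t : ℕ) (x : S) (A : Finset S) :
    |∑ y ∈ A, (P ^ t) x y - ∑ y ∈ A, π y| ≤ mixDist P π t :=
  (le_ciSup (f := fun A : Finset S => |∑ y ∈ A, (P ^ t) x y - ∑ y ∈ A, π y|)
    (Set.finite_range _).bddAbove A).trans
    (le_ciSup (f := fun x => tvDist ((P ^ t) x) π) (Set.finite_range _).bddAbove x)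

/-- If `f` grows by at most `ε` in one step on average, it grows by at most `t * ε` in `t` steps. -/
theorem pow_mulVec_le {P : Matrix S S ℝ} (hs : P ∈ rowStochastic ℝ S) {f : S → ℝ} {ε : ℝ}
    (hf : ∀ x, (P *ᵥ f) x ≤ f x + ε) (t : ℕ) (x : S) : (P ^ t *ᵥ f) x ≤ f x + t * ε := by
  induction t generalizing x with
  | zero => simp
  | succ t ih =>
    rw [pow_succ, ← mulVec_mulVec]
    calc (P ^ t *ᵥ (P *ᵥ f)) x ≤ ∑ y, (P ^ t) x y * (f y + ε) :=
          sum_le_sum fun y _ => mul_le_mul_of_nonneg_left (hf y)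
            (nonneg_of_mem_rowStochastic (pow_mem hs t))
      _ = (P ^ t *ᵥ f) x + ε := by
        simp only [mul_add, sum_add_distrib, ← sum_mul,
          sum_row_of_mem_rowStochastic (pow_mem hs t), one_mul]
        rfl
      _ ≤ f x + t * ε + ε := by gcongr; exact ih x
      _ = _ := by push_cast; ring

/-- Lower bound on the mixing time from a function that grows slowly on average: it vanishes at
`x`, while it is at least `K` off a set whose stationary probability is at most `1 / 2`. -/
theorem le_mixingTime_of_slow {P : Matrix S S ℝ} (hs : P ∈ rowStochastic ℝ S)
    (hP : P.IsPrimitive) {π : S → ℝ} (hπ : IsStationaryDistribution P π) {f : S → ℝ} {ε K T : ℝ}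
    (hf0 : ∀ y, 0 ≤ f y) (hf : ∀ y, (P *ᵥ f) y ≤ f y + ε) {x : S} (hx : f x = 0)
    {A : Finset S} (hK : ∀ y ∉ A, K ≤ f y) (hA : ∑ y ∈ A, π y ≤ 1 / 2)
    (hε : 0 < ε) (hT : T * ε ≤ K / 8) (hK0 : 0 < K) : T ≤ mixingTime P π := by
  by_contra! hlt
  -- Convergence is needed here: the `sInf` of an empty set would be 0 and would say nothing about
  -- `mixDist`.
  have hmem : mixDist P π (mixingTime P π) ≤ 1 / 4 :=
    Nat.sInf_mem (s := {t | mixDist P π t ≤ 1 / 4})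
      (exists_mixDist_le hs hP hπ (by norm_num : (0 : ℝ) < 1 / 4))
  set t := mixingTime P π
  have h1 : (P ^ t *ᵥ f) x ≤ K / 8 := by
    have := pow_mulVec_le hs hf t x
    nlinarith
  have hp : ∀ y, 0 ≤ (P ^ t) x y := fun y => nonneg_of_mem_rowStochastic (pow_mem hs t)
  -- Markov's inequality for `f`. With `h1` it leaves mass at most 1/8 off `A`, so `A` has mass at
  -- least 7/8 at time `t`.
  have h2 : K * ∑ y ∈ Aᶜ, (P ^ t) x y ≤ (P ^ t *ᵥ f) x := by
    calc K * ∑ y ∈ Aᶜ, (P ^ t) x y ≤ ∑ y ∈ Aᶜ, (P ^ t) x y * f y := by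
          rw [mul_sum]
          refine sum_le_sum fun y hy => ?_
          rw [mul_comm]
          exact mul_le_mul_of_nonneg_left (hK y (mem_compl.mp hy)) (hp y)
      _ ≤ _ := sum_le_sum_of_subset_of_nonneg (subset_univ _) fun y _ _ =>
          mul_nonneg (hp y) (hf0 y)
  have h3 : ∑ y ∈ A, (P ^ t) x y + ∑ y ∈ Aᶜ, (P ^ t) x y = 1 := by
    rw [sum_add_sum_compl, sum_row_of_mem_rowStochastic (pow_mem hs t)]
  have h4 : ∑ y ∈ Aᶜ, (P ^ t) x y ≤ 1 / 8 := by
    by_contra! h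
    nlinarith
  have h5 := (le_abs_self _).trans ((le_mixDist P π t x A).trans hmem)
  linarith

end MarkovChain

/-! ### Glauber dynamics -/

section Recolour

variable {V C : Type*} {G : SimpleGraph V}

theorem coe_recolour {α : G.Coloring C} {v : V} {c : C} [DecidableEq V]
    (h : ∀ u, G.Adj v u → α u ≠ c) : (recolour α v c : V → C) = Function.update α v c := by
  funext w
  unfold recolour
  rw [dif_pos h]
  change @Function.update V (fun _ => C) (fun _ _ => Classical.propDecidable _) α v c w = _
  congr

theorem recolour_of_adj {α : G.Coloring C} {v u : V} {c : C} (h : G.Adj v u) (hu : α u = c) :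
    recolour α v c = α := by
  unfold recolour
  rw [dif_neg fun H => H u h hu]

theorem recolour_apply_self {α : G.Coloring C} {v : V} {c : C} (h : ∀ u, G.Adj v u → α u ≠ c) :
    recolour α v c v = c := by
  classical rw [coe_recolour h, Function.update_self]

theorem recolour_apply_of_ne (α : G.Coloring C) {v w : V} (c : C) (hw : w ≠ v) :
    recolour α v c w = α w := by
  classical
  by_cases h : ∀ u, G.Adj v u → α u ≠ c
  · rw [coe_recolour h, Function.update_of_ne hw]
  · push Not at h
    obtain ⟨u, h1, h2⟩ := h
    rw [recolour_of_adj h1 h2]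

theorem recolour_eq_self (α : G.Coloring C) (v : V) : recolour α v (α v) = α := by
  classical
  apply DFunLike.coe_injective
  rw [coe_recolour fun u hu => (α.valid hu).symm, Function.update_eq_self]

theorem recolour_eq_or (α : G.Coloring C) (v : V) (c : C) :
    recolour α v c = α ∨ ∀ u, G.Adj v u → α u ≠ c := by
  by_cases h : ∀ u, G.Adj v u → α u ≠ c
  · exact Or.inr h
  · push Not at h
    obtain ⟨u, h1, h2⟩ := h
    exact Or.inl (recolour_of_adj h1 h2)

theorem recolour_recolour (α : G.Coloring C) (v : V) (c : C) :
    recolour (recolour α v c) v (α v) = α := by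
  classical
  rcases recolour_eq_or α v c with h | h
  · rw [h, recolour_eq_self]
  · apply DFunLike.coe_injective
    rw [coe_recolour, coe_recolour h, Function.update_idem, Function.update_eq_self]
    intro u hu
    rw [recolour_apply_of_ne _ _ hu.ne']
    exact (α.valid hu).symm

theorem IsFrozen.recolour_eq {α : G.Coloring C} (h : IsFrozen α) (v : V) (c : C) :
    recolour α v c = α := by
  obtain ⟨u, rfl | hu, rfl⟩ := h v c
  · exact recolour_eq_self α u
  · exact recolour_of_adj hu rfl

theorem not_isFrozen_recolour {α : G.Coloring C} (h : ¬ IsFrozen α) (v : V) (c : C) :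
    ¬ IsFrozen (recolour α v c) := fun hf => h <| by
  have := hf.recolour_eq v (α v)
  rw [recolour_recolour] at this
  rwa [this]

/-- One step of Glauber dynamics on the non-frozen colourings. -/
noncomputable def NonFrozen.step (α : NonFrozen G C) (p : V × C) : NonFrozen G C :=
  ⟨recolour α.1 p.1 p.2, not_isFrozen_recolour α.2 p.1 p.2⟩

/-- Renaming the colours of a non-frozen colouring. -/
def NonFrozen.rename (σ : Equiv.Perm C) (α : NonFrozen G C) : NonFrozen G C :=
  ⟨SimpleGraph.Coloring.mk (σ ∘ α.1) fun hab h => α.1.valid hab (σ.injective h), fun hf =>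
    α.2 fun v c => by
      obtain ⟨u, hu, huc⟩ := hf v (σ c)
      exact ⟨u, hu, σ.injective huc⟩⟩

theorem NonFrozen.rename_apply (σ : Equiv.Perm C) (α : NonFrozen G C) (v : V) :
    (α.rename σ).1 v = σ (α.1 v) := rfl

theorem NonFrozen.rename_injective (σ : Equiv.Perm C) :
    Function.Injective (NonFrozen.rename σ : NonFrozen G C → NonFrozen G C) := fun α β h => by
  apply Subtype.ext
  apply DFunLike.coe_injective
  funext v
  apply σ.injective
  rw [← rename_apply, h, rename_apply]

end Recolour

/-! ### The restricted transition matrix and its uniform stationary law. -/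

section Glauber

open Finset Matrix

variable {V C : Type*} [Fintype V] [Fintype C] {G : SimpleGraph V}

theorem glauberNonFrozen_apply (α β : NonFrozen G C) :
    glauberNonFrozen G C α β =
      (∑ p : V × C, if α.step p = β then (1 : ℝ) else 0) / (Fintype.card V * Fintype.card C) := by
  change (Nat.card {p : V × C // recolour α.1 p.1 p.2 = β.1} : ℝ) / _ = _
  rw [sum_boole, ← Fintype.card_subtype, ← Nat.card_eq_fintype_card (α := {p // α.step p = β})]
  simp only [NonFrozen.step, Subtype.ext_iff]

theorem glauberNonFrozen_nonneg (α β : NonFrozen G C) : 0 ≤ glauberNonFrozen G C α β :=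
  div_nonneg (Nat.cast_nonneg _) (by positivity)

theorem glauberNonFrozen_mulVec (f : NonFrozen G C → ℝ) (α : NonFrozen G C) :
    (glauberNonFrozen G C *ᵥ f) α =
      (∑ p : V × C, f (α.step p)) / (Fintype.card V * Fintype.card C) := by
  simp only [mulVec, dotProduct, glauberNonFrozen_apply, div_mul_eq_mul_div, ← sum_div, sum_mul]
  rw [sum_comm]
  simp

variable [Nonempty V] [Nonempty C]

theorem glauberNonFrozen_mem_rowStochastic :
    glauberNonFrozen G C ∈ rowStochastic ℝ (NonFrozen G C) := by
  refine ⟨glauberNonFrozen_nonneg, ?_⟩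
  funext α
  rw [glauberNonFrozen_mulVec]
  have h1 : (Fintype.card V : ℝ) ≠ 0 := by exact_mod_cast Fintype.card_ne_zero
  have h2 : (Fintype.card C : ℝ) ≠ 0 := by exact_mod_cast Fintype.card_ne_zero
  simp [h1, h2]

theorem glauberNonFrozen_step_pos (α : NonFrozen G C) (p : V × C) :
    0 < glauberNonFrozen G C α (α.step p) := by
  rw [glauberNonFrozen_apply]
  refine div_pos (sum_pos' (fun q _ => by positivity) ⟨p, mem_univ p, by simp⟩) ?_
  have h1 : 0 < (Fintype.card V : ℝ) := by exact_mod_cast Fintype.card_pos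
  have h2 : 0 < (Fintype.card C : ℝ) := by exact_mod_cast Fintype.card_pos
  positivity

theorem glauberNonFrozen_self_pos (α : NonFrozen G C) : 0 < glauberNonFrozen G C α α := by
  obtain ⟨v⟩ := ‹Nonempty V›
  have h := glauberNonFrozen_step_pos α (v, α.1 v)
  rwa [show α.step (v, α.1 v) = α from Subtype.ext (recolour_eq_self _ _)] at h

omit [Nonempty V] [Nonempty C]

/-- A move at `v` is sent to the move that gives `v` its old colour back. This is injective because
a move between distinct colourings must use the colour that the target has at `v`. -/
theorem card_recolour_le {α β : G.Coloring C} (h : α ≠ β) :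
    Nat.card {p : V × C // recolour α p.1 p.2 = β} ≤
      Nat.card {p : V × C // recolour β p.1 p.2 = α} := by
  refine Nat.card_le_card_of_injective
    (fun p => ⟨(p.1.1, α p.1.1),
      (congrArg (recolour · p.1.1 (α p.1.1)) p.2).symm.trans (recolour_recolour _ _ _)⟩) ?_
  have key : ∀ v c, recolour α v c = β → c = β v := fun v c hp => by
    rcases recolour_eq_or α v c with h' | h'
    · exact (h (h'.symm.trans hp)).elim
    · rw [← hp, recolour_apply_self h']
  rintro ⟨⟨v, c⟩, hp⟩ ⟨⟨w, d⟩, hq⟩ hpq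
  obtain rfl : v = w := congrArg (fun x => x.1.1) hpq
  obtain rfl := key v c hp
  obtain rfl := key v d hq
  rfl

theorem glauberNonFrozen_symm (α β : NonFrozen G C) :
    glauberNonFrozen G C α β = glauberNonFrozen G C β α := by
  by_cases h : α = β
  · rw [h]
  · have h' : α.1 ≠ β.1 := fun h' => h (Subtype.ext h')
    change (Nat.card {p : V × C // recolour α.1 p.1 p.2 = β.1} : ℝ) / _ =
      (Nat.card {p : V × C // recolour β.1 p.1 p.2 = α.1} : ℝ) / _
    rw [(card_recolour_le h').antisymm (card_recolour_le h'.symm)]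

/-- The uniform distribution is stationary for Glauber dynamics. -/
theorem isStationaryDistribution_uniform [Nonempty V] [Nonempty C] [Nonempty (NonFrozen G C)] :
    IsStationaryDistribution (glauberNonFrozen G C)
      fun _ => (Fintype.card (NonFrozen G C) : ℝ)⁻¹ where
  nonneg _ := by positivity
  sum_eq_one := by
    have : (Fintype.card (NonFrozen G C) : ℝ) ≠ 0 := by exact_mod_cast Fintype.card_ne_zero
    simp [this]
  stationary := by
    funext α
    simp only [vecMul, dotProduct, ← mul_sum]
    rw [sum_congr rfl fun β _ => glauberNonFrozen_symm β α,
      sum_row_of_mem_rowStochastic glauberNonFrozen_mem_rowStochastic, mul_one]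

/-- A set of colourings that is disjoint from its image under a renaming of the colours has
uniform probability at most `1 / 2`. -/
theorem sum_uniform_le_half (σ : Equiv.Perm C) {A : Finset (NonFrozen G C)}
    (hA : ∀ α ∈ A, α.rename σ ∉ A) :
    ∑ _α ∈ A, (Fintype.card (NonFrozen G C) : ℝ)⁻¹ ≤ 1 / 2 := by
  have hdisj : Disjoint A (A.image (NonFrozen.rename σ)) := by
    rw [Finset.disjoint_left]
    intro α hα hα'
    obtain ⟨β, hβ, rfl⟩ := mem_image.mp hα'
    exact hA β hβ hα
  have hcard := card_le_univ (A ∪ A.image (NonFrozen.rename σ))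
  rw [card_union_of_disjoint hdisj,
    card_image_of_injective _ (NonFrozen.rename_injective σ)] at hcard
  have hcard' : (#A : ℝ) + #A ≤ Fintype.card (NonFrozen G C) := by exact_mod_cast hcard
  rw [sum_const, nsmul_eq_mul, ← div_eq_mul_inv]
  exact div_le_of_le_mul₀ (by positivity) (by norm_num) (by linarith)

end Glauber

/-! ### Reachability by recolourings. -/

section Connectivity

variable {V C : Type*} {G : SimpleGraph V}

/-- Two colourings are joined by a sequence of recolourings. -/
def Reach (α β : G.Coloring C) : Prop :=
  Relation.ReflTransGen (fun α β => ∃ v c, recolour α v c = β) α β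

theorem Reach.recolour (α : G.Coloring C) (v : V) (c : C) : Reach α (recolour α v c) :=
  .single ⟨v, c, rfl⟩

theorem Reach.symm {α β : G.Coloring C} (h : Reach α β) : Reach β α := by
  induction h with
  | refl => exact .refl
  | @tail γ δ _ hs ih =>
    obtain ⟨v, c, rfl⟩ := hs
    exact .head ⟨v, γ v, recolour_recolour γ v c⟩ ih

theorem Reach.trans {α β γ : G.Coloring C} (h : Reach α β) (h' : Reach β γ) : Reach α γ :=
  Relation.ReflTransGen.trans h h'

theorem Reach.reflTransGen_glauber [Fintype V] [Fintype C] [Nonempty V] [Nonempty C]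
    {α β : G.Coloring C} (h : Reach α β) (hα : ¬ IsFrozen α) (hβ : ¬ IsFrozen β) :
    Relation.ReflTransGen (fun α β => 0 < glauberNonFrozen G C α β) ⟨α, hα⟩ ⟨β, hβ⟩ := by
  induction h with
  | refl => exact .refl
  | @tail γ δ _ hs ih =>
    obtain ⟨v, c, rfl⟩ := hs
    -- A path with a non-frozen end stays non-frozen, since a frozen colouring cannot be left.
    have hγ : ¬ IsFrozen γ := fun hf => hβ (by rwa [hf.recolour_eq])
    exact (ih hγ).tail (glauberNonFrozen_step_pos ⟨γ, hγ⟩ (v, c))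

theorem isPrimitive_glauberNonFrozen [Fintype V] [Fintype C] [Nonempty V] [Nonempty C]
    (h : ∀ α β : G.Coloring C, ¬ IsFrozen α → ¬ IsFrozen β → Reach α β) :
    (glauberNonFrozen G C).IsPrimitive :=
  isPrimitive_of_connected glauberNonFrozen_nonneg glauberNonFrozen_self_pos fun α β =>
    (h α.1 β.1 α.2 β.2).reflTransGen_glauber α.2 β.2

end Connectivity

/-! ### Adjacency in `J(ℓ)` -/

section GraphJ

variable {Δ ℓ : ℕ} [NeZero ℓ]

theorem graphJ_adj {u v : Fin (Δ + 1) × Fin ℓ} (hΔ : Δ ≠ 0) :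
    (graphJ Δ ℓ).Adj u v ↔
      (u.1 = 0 ∧ v.1 = Fin.last Δ ∧ u.2 = v.2 + 1) ∨ (v.1 = 0 ∧ u.1 = Fin.last Δ ∧ v.2 = u.2 + 1) ∨
      (v.2 = u.2 ∧ v.1 ≠ u.1 ∧ ¬ (u.1 = 0 ∧ v.1 = Fin.last Δ) ∧
        ¬ (u.1 = Fin.last Δ ∧ v.1 = 0)) := by
  have hmod : ∀ a b : Fin ℓ, (a : ℕ) = ((b : ℕ) + 1) % ℓ ↔ a = b + 1 := fun a b => by
    rw [Fin.ext_iff, Fin.val_add, Fin.val_one', Nat.add_mod_mod]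
  have h0 : (0 : Fin (Δ + 1)) ≠ Fin.last Δ := fun h => hΔ (by simpa using (congrArg Fin.val h).symm)
  obtain ⟨j, i⟩ := u
  obtain ⟨j', i'⟩ := v
  simp only [graphJ, SimpleGraph.fromRel_adj, hmod, ne_eq, Prod.mk.injEq]
  grind

theorem graphJ_adj_middle {j : Fin (Δ + 1)} {i : Fin ℓ} {v : Fin (Δ + 1) × Fin ℓ} (hΔ : Δ ≠ 0)
    (h0 : j ≠ 0) (h1 : j ≠ Fin.last Δ) :
    (graphJ Δ ℓ).Adj (j, i) v ↔ v.2 = i ∧ v.1 ≠ j := by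
  rw [graphJ_adj hΔ]
  grind

theorem graphJ_adj_first {i : Fin ℓ} {v : Fin (Δ + 1) × Fin ℓ} (hΔ : Δ ≠ 0) :
    (graphJ Δ ℓ).Adj (0, i) v ↔
      v = (Fin.last Δ, i - 1) ∨ (v.2 = i ∧ v.1 ≠ 0 ∧ v.1 ≠ Fin.last Δ) := by
  have h0 : (0 : Fin (Δ + 1)) ≠ Fin.last Δ := fun h => hΔ (by simpa using (congrArg Fin.val h).symm)
  obtain ⟨j', i'⟩ := v
  rw [graphJ_adj hΔ, Prod.mk.injEq, eq_sub_iff_add_eq]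
  grind

theorem graphJ_adj_last {i : Fin ℓ} {v : Fin (Δ + 1) × Fin ℓ} (hΔ : Δ ≠ 0) :
    (graphJ Δ ℓ).Adj (Fin.last Δ, i) v ↔
      v = (0, i + 1) ∨ (v.2 = i ∧ v.1 ≠ 0 ∧ v.1 ≠ Fin.last Δ) := by
  have h0 : (0 : Fin (Δ + 1)) ≠ Fin.last Δ := fun h => hΔ (by simpa using (congrArg Fin.val h).symm)
  obtain ⟨j', i'⟩ := v
  rw [graphJ_adj hΔ, Prod.mk.injEq]
  grind

theorem graphJ_isRegularOfDegree (hΔ : Δ ≠ 0) : (graphJ Δ ℓ).IsRegularOfDegree Δ := by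
  have h0 : (0 : Fin (Δ + 1)) ≠ Fin.last Δ := fun h => hΔ (by simpa using (congrArg Fin.val h).symm)
  rintro ⟨j, i⟩
  -- Each class `j' ≠ j` contains exactly one neighbour of `(j, i)`, namely `nb j'`.
  let nb : Fin (Δ + 1) → Fin (Δ + 1) × Fin ℓ := fun j' =>
    (j', if j = 0 ∧ j' = Fin.last Δ then i - 1 else if j = Fin.last Δ ∧ j' = 0 then i + 1 else i)
  have hnb : (graphJ Δ ℓ).neighborFinset (j, i) = (Finset.univ.erase j).image nb := by
    ext ⟨j', i'⟩
    rw [SimpleGraph.mem_neighborFinset, graphJ_adj hΔ]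
    simp only [Finset.mem_image, Finset.mem_erase, Finset.mem_univ, and_true, nb, Prod.mk.injEq]
    have hs : i = i' + 1 ↔ i' = i - 1 := by rw [eq_sub_iff_add_eq, eq_comm]
    rw [hs]
    constructor
    · intro h
      refine ⟨j', ?_, rfl, ?_⟩
      · rintro rfl
        rcases h with ⟨h, h', -⟩ | ⟨h, h', -⟩ | ⟨-, h, -⟩
        · exact h0 (h.symm.trans h')
        · exact h0 (h.symm.trans h')
        · exact h rfl
      · split_ifs <;> grind
    · rintro ⟨_, hj, rfl, hi⟩
      split_ifs at hi <;> grind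
  rw [← SimpleGraph.card_neighborFinset_eq_degree, hnb,
    Finset.card_image_of_injective _ fun a b h => congrArg Prod.fst h]
  simp

end GraphJ

/-! ### Connectivity of the non-frozen colourings of `J(ℓ)` -/

section GraphJConnectivity

variable {Δ ℓ : ℕ} [NeZero ℓ]

/-- The first and the last vertex of the block `i` have the same colour. -/
def IsOpenBlock (α : (graphJ Δ ℓ).Coloring (Fin (Δ + 1))) (i : Fin ℓ) : Prop :=
  α (0, i) = α (Fin.last Δ, i)

omit [NeZero ℓ] in
theorem Fin.zero_ne_last_of_three_le (hΔ : 3 ≤ Δ) : (0 : Fin (Δ + 1)) ≠ Fin.last Δ := fun h => by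
  have := congrArg Fin.val h
  simp at this
  omega

theorem Fin.add_one_ne (hℓ : 2 ≤ ℓ) (i : Fin ℓ) : i + 1 ≠ i := fun h => by
  rw [add_eq_left] at h
  have := congrArg Fin.val h
  rw [Fin.val_one', Nat.mod_eq_of_lt hℓ] at this
  simp at this

theorem Fin.sub_one_ne (hℓ : 2 ≤ ℓ) (i : Fin ℓ) : i - 1 ≠ i := fun h => by
  have := Fin.add_one_ne hℓ (i - 1)
  rw [sub_add_cancel] at this
  exact this h.symm

omit [NeZero ℓ] in
theorem exists_ne_three (hΔ : 3 ≤ Δ) (a b c : Fin (Δ + 1)) : ∃ d, d ≠ a ∧ d ≠ b ∧ d ≠ c := by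
  obtain ⟨d, -, hd⟩ := Finset.exists_mem_notMem_of_card_lt_card
    (s := ({a, b, c} : Finset (Fin (Δ + 1)))) (t := Finset.univ)
    (Finset.card_le_three.trans_lt (by rw [Finset.card_univ, Fintype.card_fin]; omega))
  simp only [Finset.mem_insert, Finset.mem_singleton, not_or] at hd
  exact ⟨d, hd⟩

variable {α β : (graphJ Δ ℓ).Coloring (Fin (Δ + 1))} {i : Fin ℓ}

theorem coloring_ne_of_middle (hΔ : 3 ≤ Δ) {j j' : Fin (Δ + 1)} (h0 : j ≠ 0)
    (h1 : j ≠ Fin.last Δ) (h : j' ≠ j) : α (j', i) ≠ α (j, i) :=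
  (α.valid ((graphJ_adj_middle (by omega) h0 h1).mpr ⟨rfl, h⟩)).symm

omit [NeZero ℓ] in
-- Pigeonhole: Δ+1 vertices, two of them of the same colour, cannot show all Δ+1 colours.
theorem IsOpenBlock.exists_hole (h : IsOpenBlock α i) (hΔ : 3 ≤ Δ) : ∃ c, ∀ j, α (j, i) ≠ c := by
  by_contra! hs
  have hinj : Function.Injective fun j => α (j, i) := Finite.injective_iff_surjective.mpr hs
  exact Fin.zero_ne_last_of_three_le hΔ (hinj h)

/-- A middle vertex of a block may be given any colour that does not appear in the block. -/
theorem recolour_middle_apply (hΔ : 3 ≤ Δ) {j : Fin (Δ + 1)} (h0 : j ≠ 0) (h1 : j ≠ Fin.last Δ)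
    {c : Fin (Δ + 1)} (hc : ∀ j', j' ≠ j → α (j', i) ≠ c) : recolour α (j, i) c (j, i) = c :=
  recolour_apply_self fun u hu => by
    obtain ⟨j', i'⟩ := u
    obtain ⟨rfl, hne⟩ := (graphJ_adj_middle (by omega) h0 h1).mp hu
    exact hc j' hne

/-- In an open block, any colour but that of the ends can be freed. -/
theorem IsOpenBlock.exists_free (h : IsOpenBlock α i) (hΔ : 3 ≤ Δ) {c : Fin (Δ + 1)}
    (hc : α (0, i) ≠ c) :
    ∃ β, Reach α β ∧ (∀ u, u.2 ≠ i → β u = α u) ∧ β (0, i) = α (0, i) ∧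
      β (Fin.last Δ, i) = α (Fin.last Δ, i) ∧ ∀ j, β (j, i) ≠ c := by
  by_cases hw : ∀ j, α (j, i) ≠ c
  · exact ⟨α, .refl, fun _ _ => rfl, rfl, rfl, hw⟩
  push Not at hw
  obtain ⟨w, rfl⟩ := hw
  -- The vertex `w` of colour `c` is a middle one, so it is the only such vertex in the block;
  -- moving it to the missing colour `d` frees `c`.
  obtain ⟨d, hd⟩ := h.exists_hole hΔ
  have hw0 : w ≠ 0 := by rintro rfl; exact hc rfl
  have hw1 : w ≠ Fin.last Δ := by rintro rfl; exact hc h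
  have key : ∀ j, j ≠ w → recolour α (w, i) d (j, i) = α (j, i) := fun j hj =>
    recolour_apply_of_ne _ _ fun h => hj (congrArg Prod.fst h)
  refine ⟨_, .recolour α (w, i) d, fun u hu =>
      recolour_apply_of_ne _ _ fun h => hu (congrArg Prod.snd h),
    key _ hw0.symm, key _ hw1.symm, fun j => ?_⟩
  by_cases hj : j = w
  · rw [hj, recolour_middle_apply hΔ hw0 hw1 fun j _ => hd j]
    exact (hd w).symm
  · rw [key j hj]
    exact coloring_ne_of_middle hΔ hw0 hw1 hj

/-- The ends of an open block can be given any colour that the adjacent blocks allow. -/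
theorem IsOpenBlock.exists_ends (h : IsOpenBlock α i) (hΔ : 3 ≤ Δ) (hℓ : 2 ≤ ℓ) {c : Fin (Δ + 1)}
    (hl : α (Fin.last Δ, i - 1) ≠ c) (hr : α (0, i + 1) ≠ c) :
    ∃ β, Reach α β ∧ (∀ u, u.2 ≠ i → β u = α u) ∧ β (0, i) = c ∧ β (Fin.last Δ, i) = c := by
  have h0l := Fin.zero_ne_last_of_three_le hΔ
  by_cases hc : α (0, i) = c
  · exact ⟨α, .refl, fun _ _ => rfl, hc, h.symm.trans hc⟩
  obtain ⟨β, hβ, hoff, hβ0, hβ1, hfree⟩ := h.exists_free hΔ hc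
  rw [← hoff _ (Fin.sub_one_ne hℓ i)] at hl
  rw [← hoff _ (Fin.add_one_ne hℓ i)] at hr
  have e0 : recolour β (0, i) c (0, i) = c := recolour_apply_self fun u hu => by
    obtain rfl | ⟨hu, -⟩ := (graphJ_adj_first (by omega)).mp hu
    · exact hl
    · obtain ⟨j, _⟩ := u
      obtain rfl := hu
      exact hfree j
  set γ := recolour β (0, i) c with hγ
  have hγoff : ∀ u, u ≠ (0, i) → γ u = β u := fun u hu => recolour_apply_of_ne _ _ hu
  have e1 : recolour γ (Fin.last Δ, i) c (Fin.last Δ, i) = c := recolour_apply_self fun u hu => by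
    obtain rfl | ⟨hu, hu0, -⟩ := (graphJ_adj_last (by omega)).mp hu
    · rwa [hγoff _ fun h => Fin.add_one_ne hℓ i (congrArg Prod.snd h)]
    · rw [hγoff _ fun h => hu0 (congrArg Prod.fst h)]
      obtain ⟨j, _⟩ := u
      obtain rfl := hu
      exact hfree j
  refine ⟨recolour γ (Fin.last Δ, i) c, (hβ.trans (.recolour _ _ _)).trans (.recolour _ _ _),
    fun u hu => ?_, ?_, e1⟩
  · rw [recolour_apply_of_ne _ _ fun h => hu (congrArg Prod.snd h),
      hγoff _ fun h => hu (congrArg Prod.snd h), hoff u hu]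
  · rw [recolour_apply_of_ne _ _ fun h => h0l (congrArg Prod.fst h), e0]

/-- The block after an open block can be opened. -/
theorem IsOpenBlock.exists_open_next (h : IsOpenBlock α i) (hΔ : 3 ≤ Δ) (hℓ : 2 ≤ ℓ) :
    ∃ β, Reach α β ∧ IsOpenBlock β (i + 1) ∧ ∀ i', IsOpenBlock α i' → IsOpenBlock β i' := by
  have h0l := Fin.zero_ne_last_of_three_le hΔ
  by_cases hop : IsOpenBlock α (i + 1)
  · exact ⟨α, .refl, hop, fun _ => id⟩
  -- The first two conditions make `x` available for both ends of block `i`. The third removes the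
  -- only obstacle to giving the first vertex of block `i + 1` the colour of its last vertex. Four
  -- colours are needed.
  obtain ⟨x, hx1, hx2, hx3⟩ :=
    exists_ne_three hΔ (α (Fin.last Δ, i - 1)) (α (0, i + 1)) (α (Fin.last Δ, i + 1))
  obtain ⟨β, hβ, hoff, hβ0, hβ1⟩ := h.exists_ends hΔ hℓ hx1.symm hx2.symm
  have hb := hoff (Fin.last Δ, i + 1) (Fin.add_one_ne hℓ i)
  set c := α (Fin.last Δ, i + 1)
  have e0 : recolour β (0, i + 1) c (0, i + 1) = c := recolour_apply_self fun u hu => by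
    obtain rfl | ⟨hu, hu0, hu1⟩ := (graphJ_adj_first (by omega)).mp hu
    · rwa [add_sub_cancel_right, hβ1]
    · rw [← hb]
      obtain ⟨j, _⟩ := u
      obtain rfl := hu
      exact (coloring_ne_of_middle hΔ hu0 hu1 hu1.symm).symm
  have key : ∀ u, u ≠ (0, i + 1) → recolour β (0, i + 1) c u = β u := fun u hu =>
    recolour_apply_of_ne _ _ hu
  have hlast : ∀ i', recolour β (0, i + 1) c (Fin.last Δ, i') = β (Fin.last Δ, i') := fun i' =>
    key _ fun h => h0l (congrArg Prod.fst h).symm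
  have hopen : IsOpenBlock (recolour β (0, i + 1) c) (i + 1) := by
    rw [IsOpenBlock, e0, hlast, hb]
  refine ⟨_, hβ.trans (.recolour β (0, i + 1) c), hopen, fun i' hi' => ?_⟩
  by_cases h1 : i' = i + 1
  · rwa [h1]
  rw [IsOpenBlock, hlast, key _ fun h => h1 (congrArg Prod.snd h)]
  by_cases h2 : i' = i
  · rw [h2, hβ0, hβ1]
  · rw [hoff _ h2, hoff _ h2]
    exact hi'

theorem IsOpenBlock.exists_all_open (h : IsOpenBlock α i) (hΔ : 3 ≤ Δ) (hℓ : 2 ≤ ℓ) :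
    ∃ β, Reach α β ∧ ∀ i', IsOpenBlock β i' := by
  have key : ∀ n : ℕ, ∃ β, Reach α β ∧ ∀ m ≤ n, IsOpenBlock β (i + Fin.ofNat ℓ m) := by
    intro n
    induction n with
    | zero =>
      refine ⟨α, .refl, fun m hm => ?_⟩
      obtain rfl : m = 0 := by omega
      simpa using h
    | succ n ih =>
      obtain ⟨β, hβ, ho⟩ := ih
      obtain ⟨γ, hγ, ho1, ho2⟩ := (ho n le_rfl).exists_open_next hΔ hℓ
      refine ⟨γ, hβ.trans hγ, fun m hm => ?_⟩
      rcases Nat.le_succ_iff.mp hm with hm | rfl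
      · exact ho2 _ (ho m hm)
      · convert ho1 using 1
        rw [add_assoc]
        congr 1
        apply Fin.ext
        simp [Fin.val_add]
  obtain ⟨β, hβ, ho⟩ := key ℓ
  refine ⟨β, hβ, fun i' => ?_⟩
  have := ho (i' - i).val (i' - i).isLt.le
  rwa [Fin.ofNat_val_eq_self, add_sub_cancel] at this

/-- A non-frozen colouring has an open block, or one that can be opened by one recolouring. -/
theorem exists_of_closer_not_isFrozen (hα : ¬ IsFrozen α) (hΔ : 3 ≤ Δ) :
    ∃ β i, Reach α β ∧ IsOpenBlock β i := by
  have h0l := Fin.zero_ne_last_of_three_le hΔ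
  by_cases hex : ∃ i, IsOpenBlock α i
  · obtain ⟨i, hi⟩ := hex
    exact ⟨α, i, .refl, hi⟩
  push Not at hex
  -- Without open blocks, every block shows each colour exactly once. A colour missing at some
  -- vertex then sits at a non-neighbour in its block, so the two are the ends.
  have hsurj : ∀ i c, ∃ j, α (j, i) = c := fun i => by
    refine Finite.injective_iff_surjective.mp fun j j' hjj => ?_
    by_contra hne
    have hmid : ∀ {j j'}, j ≠ 0 → j ≠ Fin.last Δ → j' ≠ j → α (j', i) ≠ α (j, i) :=
      coloring_ne_of_middle hΔ
    have h1 := hex i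
    rw [IsOpenBlock] at h1
    have hjj : α (j, i) = α (j', i) := hjj
    by_cases hj0 : j = 0
    · by_cases hj' : j' = Fin.last Δ
      · rw [hj0, hj'] at hjj
        exact h1 hjj
      · exact hmid (fun h => hne (hj0.trans h.symm)) hj' hne hjj
    · by_cases hj1 : j = Fin.last Δ
      · by_cases hj' : j' = 0
        · rw [hj1, hj'] at hjj
          exact h1 hjj.symm
        · exact hmid hj' (fun h => hne (hj1.trans h.symm)) hne hjj
      · exact hmid hj0 hj1 (Ne.symm hne) hjj.symm
  simp only [IsFrozen, not_forall, not_exists, not_and] at hα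
  obtain ⟨⟨j, i⟩, c, hc⟩ := hα
  obtain ⟨j', hj'⟩ := hsurj i c
  have hrec : recolour α (j, i) c (j, i) = c := recolour_apply_self fun u hu => hc u (.inr hu)
  have hne : j' ≠ j := by rintro rfl; exact hc _ (.inl rfl) hj'
  have hoff := recolour_apply_of_ne α c (v := (j, i)) (w := (j', i)) fun h =>
    hne (congrArg Prod.fst h)
  have hnadj : ¬ (graphJ Δ ℓ).Adj (j, i) (j', i) := fun h => hc _ (.inr h) hj'
  refine ⟨_, i, .recolour α (j, i) c, ?_⟩
  by_cases hj0 : j = 0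
  · subst hj0
    have : j' = Fin.last Δ := by
      by_contra h
      exact hnadj ((graphJ_adj_first (by omega)).mpr (.inr ⟨rfl, hne, h⟩))
    subst this
    rw [IsOpenBlock, hrec, hoff, hj']
  · by_cases hj1 : j = Fin.last Δ
    · subst hj1
      have : j' = 0 := by
        by_contra h
        exact hnadj ((graphJ_adj_last (by omega)).mpr (.inr ⟨rfl, h, hne⟩))
      subst this
      rw [IsOpenBlock, hrec, hoff, hj']
    · exact (hnadj ((graphJ_adj_middle (by omega) hj0 hj1).mpr ⟨rfl, hne⟩)).elim

/-- When all blocks are open, the ends of pairwise non-consecutive blocks can be recoloured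
at the same time. -/
theorem exists_ends_on (hΔ : 3 ≤ Δ) (hℓ : 2 ≤ ℓ) (S : Finset (Fin ℓ)) (hS : ∀ i ∈ S, i + 1 ∉ S)
    (T : Fin ℓ → Fin (Δ + 1)) (α : (graphJ Δ ℓ).Coloring (Fin (Δ + 1)))
    (hα : ∀ i, IsOpenBlock α i)
    (hT : ∀ i ∈ S, α (0, i - 1) ≠ T i ∧ α (0, i + 1) ≠ T i) :
    ∃ β, Reach α β ∧ (∀ i, IsOpenBlock β i) ∧ (∀ i ∈ S, β (0, i) = T i) ∧
      ∀ i ∉ S, β (0, i) = α (0, i) := by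
  induction S using Finset.induction_on generalizing α with
  | empty => exact ⟨α, .refl, hα, by simp, fun _ _ => rfl⟩
  | insert i S hi ih =>
    have hTi := hT i (Finset.mem_insert_self i S)
    obtain ⟨β, hβ, hoff, h0, h1⟩ :=
      (hα i).exists_ends hΔ hℓ (c := T i) (by rw [← hα]; exact hTi.1) hTi.2
    have hβo : ∀ i', IsOpenBlock β i' := fun i' => by
      by_cases h : i' = i
      · rw [h, IsOpenBlock, h0, h1]
      · rw [IsOpenBlock, hoff _ h, hoff _ h]
        exact hα i'
    obtain ⟨γ, hγ, hγo, hγS, hγoff⟩ := ih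
      (fun i' hi' h => hS i' (Finset.mem_insert_of_mem hi') (Finset.mem_insert_of_mem h)) β hβo
      fun i' hi' => by
        have hT' := hT i' (Finset.mem_insert_of_mem hi')
        rw [hoff, hoff]
        · exact hT'
        · rintro rfl
          exact hS i' (Finset.mem_insert_of_mem hi') (Finset.mem_insert_self _ _)
        · rintro rfl
          refine hS (i' - 1) (Finset.mem_insert_self _ _) ?_
          rw [sub_add_cancel]
          exact Finset.mem_insert_of_mem hi'
    refine ⟨γ, hβ.trans hγ, hγo, fun i' hi' => ?_, fun i' hi' => ?_⟩
    · rcases Finset.mem_insert.mp hi' with rfl | hi'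
      · rw [hγoff _ hi, h0]
      · exact hγS i' hi'
    · rw [Finset.mem_insert, not_or] at hi'
      rw [hγoff _ hi'.2, hoff _ hi'.1]

/-- Two colourings with all blocks open that agree on the ends of the blocks are connected. -/
theorem reach_of_ends_eq (hΔ : 3 ≤ Δ) (hα : ∀ i, IsOpenBlock α i) (hβ : ∀ i, IsOpenBlock β i)
    (h : ∀ i, α (0, i) = β (0, i)) : Reach α β := by
  classical
  induction hn : (Finset.univ.filter fun u => α u ≠ β u).card using Nat.strong_induction_on
    generalizing α with
  | _ n ih =>
  subst hn
  by_cases heq : ∀ u, α u = β u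
  · obtain rfl : α = β := DFunLike.ext _ _ heq
    exact .refl
  push Not at heq
  obtain ⟨⟨j, i⟩, hji⟩ := heq
  have hj0 : j ≠ 0 := by rintro rfl; exact hji (h i)
  have hj1 : j ≠ Fin.last Δ := by rintro rfl; exact hji (by rw [← hα, ← hβ, h])
  -- Induction step: a reachable `γ` that keeps the ends and all agreements with `β`, and gains one
  -- at `(j, i)`, has fewer disagreements.
  have of_closer : ∀ γ : (graphJ Δ ℓ).Coloring (Fin (Δ + 1)), Reach α γ →
      (∀ i, γ (0, i) = α (0, i)) → (∀ i, γ (Fin.last Δ, i) = α (Fin.last Δ, i)) →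
      (∀ u, α u = β u → γ u = β u) → γ (j, i) = β (j, i) → Reach α β := by
    intro γ hγ h0 h1 hsub hlt
    refine hγ.trans (ih _ (Finset.card_lt_card ?_) (fun i => ?_) (fun i => ?_) rfl)
    · rw [Finset.ssubset_iff_of_subset]
      · exact ⟨(j, i), by simpa using hji, by simpa using hlt⟩
      · intro u hu
        simp only [Finset.mem_filter, Finset.mem_univ, true_and] at hu ⊢
        exact fun h => hu (hsub u h)
    · rw [IsOpenBlock, h0, h1]
      exact hα i
    · rw [h0, h]
  have off : ∀ (γ : (graphJ Δ ℓ).Coloring (Fin (Δ + 1))) c {w j'} i', j' ≠ w →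
      recolour γ (w, i) c (j', i') = γ (j', i') := fun γ c w j' i' hj' =>
    recolour_apply_of_ne _ _ fun h => hj' (congrArg Prod.fst h)
  by_cases hw : ∀ j', α (j', i) ≠ β (j, i)
  · have hself := recolour_middle_apply (α := α) hΔ hj0 hj1 fun j' _ => hw j'
    refine of_closer _ (.recolour α (j, i) (β (j, i))) (fun i => off _ _ _ hj0.symm)
      (fun i => off _ _ _ hj1.symm) (fun u hu => ?_) hself
    by_cases hu' : u = (j, i)
    · rw [hu', hself]
    · rw [recolour_apply_of_ne _ _ hu', hu]
  · push Not at hw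
    obtain ⟨w, hw⟩ := hw
    have hwj : w ≠ j := by rintro rfl; exact hji hw
    have hw0 : w ≠ 0 := by
      rintro rfl
      exact coloring_ne_of_middle hΔ hj0 hj1 hwj ((h i).symm.trans hw)
    have hw1 : w ≠ Fin.last Δ := by
      rintro rfl
      refine coloring_ne_of_middle (α := β) (i := i) hΔ hj0 hj1 hwj ?_
      rw [← hβ, ← h, hα, hw]
    -- The wanted colour is held by a middle vertex `w`, which steps aside to the missing colour
    -- `d`. No agreement is lost, since `β` uses this colour at `j` and so not at `w`.
    obtain ⟨d, hd⟩ := (hα i).exists_hole hΔ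
    have hself := recolour_middle_apply (α := α) hΔ hw0 hw1 fun j' _ => hd j'
    set γ := recolour α (w, i) d with hγ
    have hself' : recolour γ (j, i) (β (j, i)) (j, i) = β (j, i) :=
      recolour_middle_apply hΔ hj0 hj1 fun j' hj' => by
        by_cases hjw : j' = w
        · rw [hjw, hself, ← hw]
          exact (hd w).symm
        · rw [hγ, off _ _ _ hjw, ← hw]
          exact coloring_ne_of_middle hΔ hw0 hw1 hjw
    refine of_closer (recolour γ (j, i) (β (j, i)))
      ((Reach.recolour α (w, i) d).trans (.recolour γ (j, i) _))
      (fun i => by rw [off _ _ _ hj0.symm, hγ, off _ _ _ hw0.symm])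
      (fun i => by rw [off _ _ _ hj1.symm, hγ, off _ _ _ hw1.symm]) (fun u hu => ?_) hself'
    by_cases hu' : u = (j, i)
    · rw [hu', hself']
    · rw [recolour_apply_of_ne _ _ hu']
      by_cases huw : u = (w, i)
      · rw [huw, hw] at hu
        exact (coloring_ne_of_middle hΔ hj0 hj1 hwj hu.symm).elim
      · rw [hγ, recolour_apply_of_ne _ _ huw, hu]

omit [NeZero ℓ] in
theorem Fin.val_add_one_even_iff [NeZero ℓ] (hℓ : Even ℓ) (i : Fin ℓ) :
    Even (i + 1).val ↔ ¬ Even i.val := by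
  obtain ⟨m, hm⟩ := hℓ
  have h0 := NeZero.ne ℓ
  have hi := i.isLt
  rw [Fin.val_add, Fin.val_one', Nat.add_mod_mod]
  rcases Nat.lt_or_ge (i.val + 1) ℓ with h | h
  · rw [Nat.mod_eq_of_lt h, Nat.even_add_one]
  · rw [show i.val + 1 = ℓ by omega, Nat.mod_self, Nat.even_iff, Nat.even_iff]
    omega

/-- If `ℓ` is even, then every non-frozen colouring is connected to one in which the ends of the
blocks have the colours `0` and `1` alternately. -/
theorem exists_alternating_of_not_isFrozen (hα : ¬ IsFrozen α) (hΔ : 3 ≤ Δ) (hℓ : 2 ≤ ℓ)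
    (he : Even ℓ) :
    ∃ β, Reach α β ∧ (∀ i, IsOpenBlock β i) ∧
      ∀ i : Fin ℓ, β (0, i) = if Even i.val then 0 else 1 := by
  classical
  have h01 : (0 : Fin (Δ + 1)) ≠ 1 := fun h => by
    have := congrArg Fin.val h
    rw [Fin.val_one', Nat.mod_eq_of_lt (by omega)] at this
    simp at this
  have hadd := Fin.val_add_one_even_iff he
  have hsub : ∀ i : Fin ℓ, Even (i - 1).val ↔ ¬ Even i.val := fun i => by
    have := hadd (i - 1)
    rw [sub_add_cancel] at this
    tauto
  obtain ⟨β, i, hβ, hi⟩ := exists_of_closer_not_isFrozen hα hΔ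
  obtain ⟨γ, hγ, hγo⟩ := hi.exists_all_open hΔ hℓ
  let E : Finset (Fin ℓ) := Finset.univ.filter fun i => Even i.val
  let O : Finset (Fin ℓ) := Finset.univ.filter fun i => ¬ Even i.val
  have hE : ∀ i, i ∈ E ↔ Even i.val := fun i => by simp [E]
  have hO : ∀ i, i ∈ O ↔ ¬ Even i.val := fun i => by simp only [O, Finset.mem_filter_univ]
  have hE' : ∀ i ∈ E, i + 1 ∉ E := fun i => by rw [hE, hE, hadd]; tauto
  have hO' : ∀ i ∈ O, i + 1 ∉ O := fun i => by rw [hO, hO, hadd]; tauto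
  -- Three rounds: clear the colour `0` from the odd blocks, give it to all even ones, then give `1`
  -- to all odd ones.
  choose T hT1 hT2 hT3 using fun i => exists_ne_three hΔ (γ (0, i - 1)) (γ (0, i + 1)) 0
  obtain ⟨δ, hδ, hδo, hδ1, -⟩ := exists_ends_on hΔ hℓ O hO' T γ hγo
    fun i _ => ⟨(hT1 i).symm, (hT2 i).symm⟩
  have hδ0 : ∀ i, ¬ Even i.val → δ (0, i) ≠ 0 := fun i hi => by
    rw [hδ1 i ((hO i).mpr hi)]
    exact hT3 i
  obtain ⟨ε, hε, hεo, hε1, -⟩ := exists_ends_on hΔ hℓ E hE' (fun _ => 0) δ hδo fun i hi => by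
    rw [hE] at hi
    exact ⟨hδ0 _ (by rw [hsub]; tauto), hδ0 _ (by rw [hadd]; tauto)⟩
  have hε0 : ∀ i, Even i.val → ε (0, i) ≠ 1 := fun i hi => by
    rw [hε1 i ((hE i).mpr hi)]
    exact h01
  obtain ⟨ζ, hζ, hζo, hζ1, hζ0⟩ := exists_ends_on hΔ hℓ O hO' (fun _ => 1) ε hεo fun i hi => by
    rw [hO] at hi
    exact ⟨hε0 _ (by rw [hsub]; tauto), hε0 _ (by rw [hadd]; tauto)⟩
  refine ⟨ζ, hβ.trans (hγ.trans (hδ.trans (hε.trans hζ))), hζo, fun i => ?_⟩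
  split_ifs with h
  · rw [hζ0 i (by rw [hO]; tauto), hε1 i ((hE i).mpr h)]
  · exact hζ1 i ((hO i).mpr h)

/-- If `ℓ` is even, then the non-frozen colourings of `J(ℓ)` are connected by recolourings. -/
theorem reach_of_not_isFrozen (hΔ : 3 ≤ Δ) (hℓ : 2 ≤ ℓ) (he : Even ℓ) (hα : ¬ IsFrozen α)
    (hβ : ¬ IsFrozen β) : Reach α β := by
  obtain ⟨γ, hγ, hγo, hγ0⟩ := exists_alternating_of_not_isFrozen hα hΔ hℓ he
  obtain ⟨δ, hδ, hδo, hδ0⟩ := exists_alternating_of_not_isFrozen hβ hΔ hℓ he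
  exact (hγ.trans (reach_of_ends_eq hΔ hγo hδo fun i => by rw [hγ0, hδ0])).trans hδ.symm

end GraphJConnectivity

/-! ### Slow spread of the recoloured blocks of `J(2k)` -/

section GraphJSlow

variable {Δ k : ℕ}

/-- The colouring `β` gives the colour `j` to the vertex `(j, i)` for every `j`. -/
def IsIntact {ℓ : ℕ} (β : (graphJ Δ ℓ).Coloring (Fin (Δ + 1))) (i : Fin ℓ) : Prop :=
  ∀ j, β (j, i) = j

/-- The cyclic distance from the block `i` to the block `0`. -/
def blockDist (i : Fin (2 * k)) : ℕ := min i.val (2 * k - i.val)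

open Classical in
/-- The largest distance to the block `0` of a block that is not intact. -/
noncomputable def front (β : (graphJ Δ (2 * k)).Coloring (Fin (Δ + 1))) : ℕ :=
  (Finset.univ.filter fun i => ¬ IsIntact β i).sup blockDist

theorem blockDist_le_front {β : (graphJ Δ (2 * k)).Coloring (Fin (Δ + 1))} {i : Fin (2 * k)}
    (h : ¬ IsIntact β i) : blockDist i ≤ front β :=
  Finset.le_sup (f := blockDist) (by simpa using h)

/-- An intact block can be changed only at one of its ends, and only to the colour of its other
end, where the adjacent block is not intact. -/
theorem IsIntact.of_recolour {ℓ : ℕ} [NeZero ℓ] {β : (graphJ Δ ℓ).Coloring (Fin (Δ + 1))}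
    {i : Fin ℓ} (hΔ : 3 ≤ Δ) (h : IsIntact β i) {v : Fin (Δ + 1) × Fin ℓ} {c : Fin (Δ + 1)}
    (hr : ¬ IsIntact (recolour β v c) i) :
    (v = (0, i) ∧ c = Fin.last Δ ∧ ¬ IsIntact β (i - 1)) ∨
      (v = (Fin.last Δ, i) ∧ c = 0 ∧ ¬ IsIntact β (i + 1)) := by
  simp only [IsIntact, not_forall] at hr
  obtain ⟨j, hj⟩ := hr
  have hv : v = (j, i) := by
    by_contra hne
    exact hj (by rw [recolour_apply_of_ne _ _ (Ne.symm hne), h])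
  subst hv
  have hfree : ∀ u, (graphJ Δ ℓ).Adj (j, i) u → β u ≠ c :=
    (recolour_eq_or β (j, i) c).resolve_left fun he => hj (by rw [he, h])
  rw [recolour_apply_self hfree] at hj
  -- In an intact block the colour `c` sits at `(c, i)`, so `j` and `c` must be the two non-adjacent
  -- ends.
  have hc : ¬ (graphJ Δ ℓ).Adj (j, i) (c, i) := fun ha => hfree _ ha (h c)
  by_cases h0 : j = 0
  · subst h0
    have hlast : c = Fin.last Δ := by
      by_contra hl
      exact hc ((graphJ_adj_first (by omega)).mpr (.inr ⟨rfl, hj, hl⟩))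
    refine .inl ⟨rfl, hlast, fun hi => ?_⟩
    exact hfree _ ((graphJ_adj_first (by omega)).mpr (.inl rfl)) ((hi _).trans hlast.symm)
  by_cases h1 : j = Fin.last Δ
  · subst h1
    have hzero : c = 0 := by
      by_contra hl
      exact hc ((graphJ_adj_last (by omega)).mpr (.inr ⟨rfl, hl, hj⟩))
    refine .inr ⟨rfl, hzero, fun hi => ?_⟩
    exact hfree _ ((graphJ_adj_last (by omega)).mpr (.inl rfl)) ((hi _).trans hzero.symm)
  exact (hc ((graphJ_adj_middle (by omega) h0 h1).mpr ⟨rfl, hj⟩)).elim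

/-- Damage moving in the direction of increasing index leaves the ball of radius `m` around block
`0` only at one place; `blockDist_add_one` treats the other direction. -/
theorem blockDist_sub_one [NeZero (2 * k)] {i : Fin (2 * k)} {m : ℕ} (hi : m < blockDist i)
    (h : blockDist (i - 1) ≤ m) : i.val = m + 1 := by
  have h0 : i ≠ 0 := by
    rintro rfl
    simp [blockDist] at hi
  have hk : 0 < 2 * k := Nat.pos_of_ne_zero (NeZero.ne _)
  have hval : (i - 1).val = i.val - 1 := by
    have h0' : i.val ≠ 0 := fun h => h0 (Fin.ext h)
    have := i.isLt
    rw [Fin.val_sub, Fin.val_one', Nat.mod_eq_of_lt (by omega : 1 < 2 * k),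
      show 2 * k - 1 + i.val = i.val - 1 + 2 * k by omega, Nat.add_mod_right,
      Nat.mod_eq_of_lt (by omega)]
  simp only [blockDist, hval] at h hi
  omega

theorem blockDist_add_one [NeZero (2 * k)] {i : Fin (2 * k)} {m : ℕ} (hi : m < blockDist i)
    (h : blockDist (i + 1) ≤ m) : i.val = 2 * k - (m + 1) := by
  have hk : 0 < 2 * k := Nat.pos_of_ne_zero (NeZero.ne _)
  have hlt := i.isLt
  have hval : (i + 1).val = (i.val + 1) % (2 * k) := by
    rw [Fin.val_add, Fin.val_one', Nat.add_mod_mod]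
  simp only [blockDist, hval] at h hi
  rcases Nat.lt_or_ge (i.val + 1) (2 * k) with hlt' | hge
  · rw [Nat.mod_eq_of_lt hlt'] at h
    omega
  · rw [show i.val + 1 = 2 * k by omega, Nat.mod_self] at h
    omega

/-- At most two choices of a vertex and a colour increase `front`, and only by one. -/
theorem front_recolour_le [NeZero (2 * k)] (hΔ : 3 ≤ Δ)
    (β : (graphJ Δ (2 * k)).Coloring (Fin (Δ + 1))) (v : Fin (Δ + 1) × Fin (2 * k))
    (c : Fin (Δ + 1)) :
    front (recolour β v c) ≤ front β +
      if (v, c) ∈ ({((0, Fin.ofNat _ (front β + 1)), Fin.last Δ),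
        ((Fin.last Δ, Fin.ofNat _ (2 * k - (front β + 1))), 0)} : Finset _) then 1 else 0 := by
  refine Finset.sup_le fun i hi => ?_
  simp only [Finset.mem_filter, Finset.mem_univ, true_and] at hi
  by_cases hle : blockDist i ≤ front β
  · exact hle.trans (Nat.le_add_right _ _)
  have hint : IsIntact β i := by
    by_contra h
    exact hle (blockDist_le_front h)
  rw [not_le] at hle
  have heq : ∀ m, i.val = m → i = Fin.ofNat _ m := fun m hm => by
    rw [← hm, Fin.ofNat_val_eq_self]
  rcases hint.of_recolour hΔ hi with ⟨rfl, rfl, h⟩ | ⟨rfl, rfl, h⟩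
  · have hv := blockDist_sub_one hle (blockDist_le_front h)
    rw [← heq _ hv, if_pos (by simp)]
    exact (min_le_left _ _).trans hv.le
  · have hv := blockDist_add_one hle (blockDist_le_front h)
    rw [← heq _ hv, if_pos (by simp)]
    have h1 := i.isLt
    have h2 : blockDist i ≤ 2 * k - i.val := min_le_right _ _
    omega

theorem glauberNonFrozen_mulVec_front_le [NeZero (2 * k)] (hΔ : 3 ≤ Δ)
    (β : NonFrozen (graphJ Δ (2 * k)) (Fin (Δ + 1))) :
    Matrix.mulVec (glauberNonFrozen (graphJ Δ (2 * k)) (Fin (Δ + 1)))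
      (fun α => (front α.1 : ℝ)) β ≤
      front β.1 + 2 / (((Δ + 1) * (2 * k)) * (Δ + 1) : ℝ) := by
  have hk : (0 : ℝ) < 2 * k := by
    exact_mod_cast Nat.pos_of_ne_zero (NeZero.ne (2 * k))
  have hN : (0 : ℝ) < ((Δ + 1) * (2 * k)) * (Δ + 1) := by positivity
  rw [glauberNonFrozen_mulVec]
  simp only [Fintype.card_prod, Fintype.card_fin]
  push_cast
  rw [div_le_iff₀ hN, add_mul, div_mul_cancel₀ _ hN.ne']
  set D : Finset ((Fin (Δ + 1) × Fin (2 * k)) × Fin (Δ + 1)) :=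
    {((0, Fin.ofNat _ (front β.1 + 1)), Fin.last Δ),
      ((Fin.last Δ, Fin.ofNat _ (2 * k - (front β.1 + 1))), 0)}
  calc ∑ p, (front (β.step p).1 : ℝ)
      ≤ ∑ p, ((front β.1 : ℝ) + if p ∈ D then 1 else 0) := by
        refine Finset.sum_le_sum fun p _ => ?_
        have := front_recolour_le hΔ β.1 p.1 p.2
        exact_mod_cast this
    _ = front β.1 * (((Δ + 1) * (2 * k)) * (Δ + 1)) + D.card := by
        rw [Finset.sum_add_distrib, Finset.sum_const, Finset.sum_boole, Finset.card_univ,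
          Finset.filter_mem_eq_inter, Finset.univ_inter]
        simp only [Fintype.card_prod, Fintype.card_fin, nsmul_eq_mul]
        push_cast
        ring
    _ ≤ _ := by
        gcongr
        exact_mod_cast Finset.card_le_two

/-- A non-frozen colouring of `J(ℓ)` in which all blocks but the block `0` are intact. -/
theorem exists_intact_off_zero {ℓ : ℕ} [NeZero ℓ] (hΔ : 3 ≤ Δ) (hℓ : 2 ≤ ℓ) :
    ∃ α : NonFrozen (graphJ Δ ℓ) (Fin (Δ + 1)), ∀ i ≠ 0, IsIntact α.1 i := by
  have h0l := Fin.zero_ne_last_of_three_le hΔ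
  have h1 : ((1 : Fin (Δ + 1)) : ℕ) = 1 := by rw [Fin.val_one', Nat.mod_eq_of_lt (by omega)]
  have h10 : (1 : Fin (Δ + 1)) ≠ 0 := fun h => by
    have := congrArg Fin.val h
    rw [h1] at this
    simp at this
  have h1l : (1 : Fin (Δ + 1)) ≠ Fin.last Δ := fun h => by
    have := congrArg Fin.val h
    rw [h1, Fin.val_last] at this
    omega
  -- Block `0` is opened: both ends get colour `1`, and the middle vertex `1` gets `0` in exchange.
  -- The colour Δ disappears from the block, which is the closed neighbourhood of `(1, 0)`.
  let g : Fin (Δ + 1) → Fin (Δ + 1) := fun j =>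
    if j = 0 ∨ j = Fin.last Δ then 1 else if j = 1 then 0 else j
  let a : Fin (Δ + 1) × Fin ℓ → Fin (Δ + 1) := fun u => if u.2 = 0 then g u.1 else u.1
  have hlink : ∀ i, a (0, i + 1) ≠ a (Fin.last Δ, i) := fun i => by
    have := Fin.add_one_ne hℓ i
    simp only [a, g]
    grind
  have ha : ∀ {u v}, (graphJ Δ ℓ).Adj u v → a u ≠ a v := by
    rintro ⟨j, i⟩ ⟨j', i'⟩ huv
    rcases (graphJ_adj (by omega)).mp huv with ⟨rfl, rfl, rfl⟩ | ⟨rfl, rfl, rfl⟩ | ⟨rfl, hne, h, h'⟩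
    · exact hlink _
    · exact (hlink _).symm
    · simp only [a, g]
      grind
  have hfree : ∀ j, g j ≠ Fin.last Δ := fun j => by
    simp only [g]
    grind
  refine ⟨⟨SimpleGraph.Coloring.mk a ha, fun hf => ?_⟩, fun i hi j => ?_⟩
  · obtain ⟨⟨j, i⟩, hu, hc⟩ := hf (1, 0) (Fin.last Δ)
    obtain rfl : i = 0 := by
      rcases hu with hu | hu
      · exact congrArg Prod.snd hu
      · exact ((graphJ_adj_middle (by omega) h10 h1l).mp hu).1
    exact hfree j hc
  · change a (j, i) = j
    simp [a, hi]

end GraphJSlow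

/-! ### The lower bound on the mixing time. -/

theorem mainTheorem2 (Δ k : ℕ) (hΔ : 3 ≤ Δ) (hk : 5 ≤ k) :
    Fintype.card (Fin (Δ + 1) × Fin (2 * k)) = 2 * k * (Δ + 1) ∧
    (graphJ Δ (2 * k)).IsRegularOfDegree Δ ∧
    IsErgodicChain (glauberNonFrozen (graphJ Δ (2 * k)) (Fin (Δ + 1))) ∧
    (∃! π, IsStationaryDistribution (glauberNonFrozen (graphJ Δ (2 * k)) (Fin (Δ + 1))) π) ∧
    ∀ π, IsStationaryDistribution (glauberNonFrozen (graphJ Δ (2 * k)) (Fin (Δ + 1))) π →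
      ((2 * k * (Δ + 1) : ℕ) : ℝ) ^ 2 / (8 * ((Δ : ℝ) + 1)) ≤
        (mixingTime (glauberNonFrozen (graphJ Δ (2 * k)) (Fin (Δ + 1))) π : ℝ) := by
  classical
  have : NeZero (2 * k) := ⟨by omega⟩
  have hs : glauberNonFrozen (graphJ Δ (2 * k)) (Fin (Δ + 1)) ∈ _ :=
    glauberNonFrozen_mem_rowStochastic
  have hprim : (glauberNonFrozen (graphJ Δ (2 * k)) (Fin (Δ + 1))).IsPrimitive :=
    isPrimitive_glauberNonFrozen fun _ _ =>
      reach_of_not_isFrozen hΔ (by omega) (even_two_mul k)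
  obtain ⟨α, hα⟩ := exists_intact_off_zero (ℓ := 2 * k) hΔ (by omega)
  have : Nonempty (NonFrozen (graphJ Δ (2 * k)) (Fin (Δ + 1))) := ⟨α⟩
  have hunif := isStationaryDistribution_uniform (G := graphJ Δ (2 * k)) (C := Fin (Δ + 1))
  refine ⟨?_, graphJ_isRegularOfDegree (by omega),
    isErgodicChain_of_isPrimitive hs glauberNonFrozen_self_pos hprim,
    ⟨_, hunif, fun ν hν => hν.unique hs hprim hunif⟩, fun π hπ => ?_⟩
  · rw [Fintype.card_prod, Fintype.card_fin, Fintype.card_fin, mul_comm]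
  obtain rfl := hπ.unique hs hprim hunif
  have hk0 : (0 : ℝ) < k := by exact_mod_cast (by omega : 0 < k)
  have hΔ' : (3 : ℝ) ≤ Δ := by exact_mod_cast hΔ
  -- The antipodal block, at distance `k` from block `0`.
  let K : Fin (2 * k) := ⟨k, by omega⟩
  have h10 : (1 : Fin (Δ + 1)) ≠ 0 := fun h => by
    have := congrArg Fin.val h
    rw [Fin.val_one', Nat.mod_eq_of_lt (by omega)] at this
    simp at this
  refine le_mixingTime_of_slow hs hprim hπ (f := fun β => (front β.1 : ℝ)) (K := k)
    (fun β => Nat.cast_nonneg _) (glauberNonFrozen_mulVec_front_le hΔ) (x := α) ?_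
    (A := Finset.univ.filter fun β => IsIntact β.1 K) (fun β hβ => ?_)
    (sum_uniform_le_half (Equiv.swap 0 1) fun β hβ hβ' => ?_) (by positivity) ?_ hk0
  · have : front α.1 = 0 := Nat.le_zero.mp <| Finset.sup_le fun i hi => by
      obtain rfl : i = 0 := by
        by_contra h
        exact (Finset.mem_filter.mp hi).2 (hα i h)
      simp [blockDist]
    simp [this]
  · have h := blockDist_le_front (β := β.1) (i := K) (by simpa using hβ)
    have hK : blockDist K = k := by simp only [blockDist, K]; omega
    rw [hK] at h
    exact_mod_cast h
  -- Swapping the colours `0` and `1` spoils the first vertex of an intact block.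
  · simp only [Finset.mem_filter, Finset.mem_univ, true_and] at hβ hβ'
    have h := hβ' 0
    rw [NonFrozen.rename_apply, hβ 0, Equiv.swap_apply_left] at h
    exact h10 h
  · push_cast
    -- The claimed time multiplied by the drift is k/(2(Δ+1)), which is at most k/8 because Δ+1 ≥ 4.
    rw [show ((2 * k * (Δ + 1) : ℝ)) ^ 2 / (8 * (Δ + 1)) *
      (2 / ((Δ + 1) * (2 * k) * (Δ + 1))) = k / (2 * (Δ + 1)) by field_simp; ring]
    exact div_le_div_of_nonneg_left hk0.le (by norm_num) (by linarith)
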